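/- A function $f:\{0,1\}^n\to\{0,1\}$ is $k$-monotone if there are no points $x_1\prec x_2\prec\dots\prec x_{k+1}$ of $\{0,1\}^n$ (in the coordinatewise order) with $f(x_1)=1$ and $f(x_i)\neq f(x_{i+1})$ for all $1\le i\le k$. The distance of two functions is the fraction of the points of $\{0,1\}^n$ where they differ, and the distance of $f$ from being $\ell$-monotone is its minimum distance to an $\ell$-monotone function. A non-adaptive $q$-query algorithm chooses at most $q$ query points from its internal randomness alone, and then accepts or rejects depending on its randomness and on the values of $f$ at these points. It is a one-sided $(k,\ell)$-tester with proximity parameter $\varepsilon$ if it accepts every $k$-monotone $f$ with probability $1$ and rejects every $f$ at distance more than $\varepsilon$ from being $\ell$-monotone with probability at least $2/3$. Theorem. There are absolute constants $c>0$ and $\varepsilon_0>0$ such that the following holds. Let $k=k(n)$ and $g=g(k,n)$ be integers with $2\le k\le g(k,n)$ for all large $n$ and $g(k,n)=o(\sqrt n)$ as $n\to\infty$. Then for all sufficiently large $n$ and every $0<\varepsilon\le\varepsilon_0$, every non-adaptive one-sided $(k,g(k,n))$-tester on $\{0,1\}^n$ with proximity parameter $\varepsilon$ makes at least $$\exp\left(c\cdot\frac{\sqrt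 n}{(k+1)\,(g(k,n)/k)^2}\right)$$ queries. -/

import Mathlib

namespace PropertyTesting

/-- The hypercube `{0,1}^n`. Its order is the coordinatewise one. -/
abbrev Cube (n : ℕ) : Type := Fin n → Bool

/-- Boolean functions on the hypercube. -/
abbrev BoolFun (n : ℕ) : Type := Cube n → Bool

/-- A violation of `k`-monotonicity of `f`: points `x 0 ≺ x 1 ≺ ⋯ ≺ x k` such that `f` is `1` at the
first one and changes its value at each of the `k` steps. -/
def IsViolation {n k : ℕ} (f : BoolFun n) (x : Fin (k + 1) → Cube n) : Prop :=
  StrictMono x ∧ f (x 0) = true ∧ ∀ i : Fin k, f (x i.castSucc) ≠ f (x i.succ)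

/-- The set of `k`-monotone functions: those without a violation of `k`-monotonicity. -/
def kMonotone (n k : ℕ) : Set (BoolFun n) :=
  {f | ¬ ∃ x : Fin (k + 1) → Cube n, IsViolation f x}

/-- Normalized Hamming distance: the fraction of points where `f` and `g` differ. -/
noncomputable def relDist {n : ℕ} (f g : BoolFun n) : ℝ :=
  ((Finset.univ.filter fun x => f x ≠ g x).card : ℝ) / 2 ^ n

/-- The distance of `f` to a (nonempty) property: the least distance to one of its members. -/
noncomputable def distTo {n : ℕ} (f : BoolFun n) (P : Set (BoolFun n)) : ℝ :=
  sInf (relDist f '' P)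

/-- The infimum in the distance to `k`-monotonicity is over a nonempty set. -/
theorem kMonotone_nonempty (n k : ℕ) : (kMonotone n k).Nonempty :=
  ⟨fun _ => false, by rintro ⟨x, -, h, -⟩; exact Bool.false_ne_true h⟩

/-- The infimum in the definition of the distance to a nonempty property is a minimum. -/
theorem exists_relDist_eq_distTo {n : ℕ} (f : BoolFun n) {P : Set (BoolFun n)} (hP : P.Nonempty) :
    ∃ g ∈ P, relDist f g = distTo f P :=
  (hP.image _).csInf_mem (P.toFinite.image _)

/-- A non-adaptive `q`-query algorithm for a fixed outcome of its coins: the queries are fixed in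
advance, and the output (`true` is ACCEPT, `false` is REJECT) is a function of the answers. Queries
may be repeated, so this covers algorithms that make at most `q` queries. -/
structure DetNonadaptive (n q : ℕ) where
  query : Fin q → Cube n
  output : (Fin q → Bool) → Bool

/-- The output of the algorithm with oracle access to `f`. -/
def DetNonadaptive.run {n q : ℕ} (A : DetNonadaptive n q) (f : BoolFun n) : Bool :=
  A.output fun i => f (A.query i)

/-- A randomized non-adaptive `q`-query algorithm: its coins select the queries and the output rule,
independently of the unknown function. -/
abbrev RandNonadaptive (n q : ℕ) : Type := PMF (DetNonadaptive n q)

/-- The distribution of the output (`true` is ACCEPT, `false` is REJECT) on the function `f`. -/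
noncomputable def RandNonadaptive.outputDist {n q : ℕ} (T : RandNonadaptive n q) (f : BoolFun n) :
    PMF Bool :=
  PMF.map (fun A => A.run f) T

/-- `T` is a one-sided `(k, l)`-tester for monotonicity with proximity parameter `ε`: it accepts
every `k`-monotone function with probability `1`, and rejects every function at distance more than
`ε` from `l`-monotonicity with probability at least `2/3`. -/
def IsOneSidedTester {n q : ℕ} (k l : ℕ) (ε : ℝ) (T : RandNonadaptive n q) : Prop :=
  (∀ f ∈ kMonotone n k, RandNonadaptive.outputDist T f true = 1) ∧
    ∀ f : BoolFun n, ε < distTo f (kMonotone n l) →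
      2 / 3 ≤ RandNonadaptive.outputDist T f false

end PropertyTesting

open PropertyTesting Filter Asymptotics

namespace PropertyTesting

/-! A one-sided tester can reject only when its queries contain a violation. If they contain none,
the answers are the parity of a monotone rank with values at most `k`, and this parity is a
`k`-monotone function that agrees with the input on the queries (`exists_rank`). Averaging over the
coins, it suffices to find a finite family of far functions such that any fixed `q` queries contain
violations for few of its members.

The family is `blockParity A w K`, for all sets `A` of a fixed size `2m`.

Farness: fix the coordinates outside `A`. Along a maximal chain of the cube on `A`, the function
alternates on blocks of length `w`, while a `g`-monotone function is the parity of a rank that rises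
by at most `g` in total. So they differ on at least half of every double block on which the rank is
constant. Averaging over maximal chains (`le_card_blockErrors`) gives a constant fraction of errors
once `√m` is a large enough multiple of `wg`.

Hardness: a violation crosses about `k` blocks, so it contains comparable points in the middle
layers whose difference `D` meets `A` in at least `t = w(2⌊k/2⌋ - 1)` elements. But `|D| ≤ 4√n`, so
if `t` is several times `8m/√n`, a random `A` does this with probability at most `exp(-t)`. A union
bound over `q²` pairs of queries follows. With `m = 32(wg)²` this allows `w` of order `k√n/g²`,
which is the claimed exponent up to a constant. -/

variable {n : ℕ}

/-! ### Rank functions and `k`-monotonicity -/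

/-- Below `x` there is a chain of `r` points of `Q` along which `f` alternates, starting with `1`. -/
def AltChainBelow (Q : Set (Cube n)) (f : BoolFun n) : ℕ → Cube n → Prop
  | 0, _ => True
  | r + 1, x => ∃ y ∈ Q, y ≤ x ∧ f y = decide (Odd (r + 1)) ∧ AltChainBelow Q f r y

theorem AltChainBelow.mono {Q : Set (Cube n)} {f : BoolFun n} {r : ℕ} {x y : Cube n} (h : x ≤ y)
    (hx : AltChainBelow Q f r x) : AltChainBelow Q f r y := by
  cases r with
  | zero => trivial
  | succ r =>
    obtain ⟨z, hz, hzx, h1, h2⟩ := hx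
    exact ⟨z, hz, hzx.trans h, h1, h2⟩

/-- `AltChainBelow` asks only for `≤`; the steps are strict because consecutive values differ. -/
theorem AltChainBelow.exists_chain {Q : Set (Cube n)} {f : BoolFun n} {r : ℕ} {x : Cube n}
    (hx : AltChainBelow Q f (r + 1) x) :
    ∃ c : ℕ → Cube n, (∀ i ≤ r, c i ∈ Q ∧ f (c i) = decide (Even i)) ∧
      (∀ i < r, c i < c (i + 1)) ∧ c r ≤ x := by
  induction r generalizing x with
  | zero =>
    obtain ⟨y, hy, hyx, h1, -⟩ := hx
    refine ⟨fun _ => y, ?_, by simp, hyx⟩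
    intro i hi
    obtain rfl : i = 0 := by omega
    simpa using ⟨hy, h1⟩
  | succ r ih =>
    obtain ⟨y, hy, hyx, h1, h2⟩ := hx
    obtain ⟨c, hc1, hc2, hc3⟩ := ih h2
    have hpar : f y = decide (Even (r + 1)) := by
      rw [h1]; simp [Nat.odd_add_one, Nat.even_add_one]
    have hlt : c r < y := by
      refine lt_of_le_of_ne hc3 fun h => ?_
      have h3 := (hc1 r le_rfl).2
      rw [h, hpar] at h3
      simp only [Nat.even_add_one, decide_eq_decide] at h3
      tauto
    refine ⟨Function.update c (r + 1) y, ?_, ?_, by simpa using hyx⟩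
    · intro i hi
      rcases eq_or_lt_of_le hi with rfl | hi
      · simpa using ⟨hy, hpar⟩
      · rw [Function.update_of_ne (by omega)]
        exact hc1 i (by omega)
    · intro i hi
      rw [Function.update_of_ne (by omega)]
      rcases eq_or_lt_of_le (Nat.le_of_lt_succ hi) with rfl | hi
      · simpa using hlt
      · rw [Function.update_of_ne (by omega)]
        exact hc2 i hi

/-- If `Q` contains no violation of `k`-monotonicity of `f`, then on `Q` the function `f` is the
parity of a monotone function with values at most `k`. -/
theorem exists_rank {k : ℕ} {Q : Set (Cube n)} {f : BoolFun n}
    (h : ¬ ∃ x : Fin (k + 1) → Cube n, (∀ i, x i ∈ Q) ∧ IsViolation f x) :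
    ∃ ρ : Cube n → ℕ, Monotone ρ ∧ (∀ x, ρ x ≤ k) ∧ ∀ x ∈ Q, f x = decide (Odd (ρ x)) := by
  classical
  have hk : ∀ x, ¬ AltChainBelow Q f (k + 1) x := by
    intro x hx
    obtain ⟨c, hc1, hc2, -⟩ := hx.exists_chain
    refine h ⟨fun i => c i, fun i => (hc1 i (by omega)).1, ?_, ?_, ?_⟩
    · rw [Fin.strictMono_iff_lt_succ]
      intro i
      exact hc2 i i.2
    · simpa using (hc1 0 (by omega)).2
    · intro i
      have h1 := (hc1 i (by omega)).2
      have h2 := (hc1 (i + 1) (by omega)).2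
      simp only [Fin.val_castSucc, Fin.val_succ, h1, h2]
      simp only [Nat.even_add_one, ne_eq, decide_eq_decide]
      tauto
  -- The rank of `x` is the length of the longest alternating chain of `Q` below it.
  refine ⟨fun x => Nat.findGreatest (fun r => AltChainBelow Q f r x) k, ?_,
    fun x => Nat.findGreatest_le k, ?_⟩
  · intro x y hxy
    exact Nat.findGreatest_mono_left (fun r hr => hr.mono hxy) k
  · intro x hx
    suffices H : ∀ r, Nat.findGreatest (fun r => AltChainBelow Q f r x) k = r →
      f x = decide (Odd r) from H _ rfl
    intro r hr
    have h1 : AltChainBelow Q f r x := by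
      rw [← hr]
      exact Nat.findGreatest_spec (P := fun r => AltChainBelow Q f r x) (Nat.zero_le k) trivial
    have h2 : ¬ AltChainBelow Q f (r + 1) x := by
      have hrk : r ≤ k := hr ▸ Nat.findGreatest_le k
      rcases eq_or_lt_of_le hrk with rfl | hlt
      · exact hk x
      · exact Nat.findGreatest_is_greatest (P := fun r => AltChainBelow Q f r x)
          (by rw [hr]; omega) hlt
    -- Otherwise `x` itself would prolong the chain of length `r`.
    have h3 : f x ≠ decide (Odd (r + 1)) := fun h3 => h2 ⟨x, hx, le_rfl, h3, h1⟩
    by_cases ho : Odd r <;> simp [ho, Nat.odd_add_one] at h3 ⊢ <;> simpa using h3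

/-- Along points where the parity of a monotone function changes at each step, the function grows
by at least one at each step. -/
theorem add_le_of_parity_changes {j : ℕ} {b : ℕ → ℕ} (hm : ∀ i < j, b i ≤ b (i + 1))
    (hc : ∀ i < j, decide (Odd (b i)) ≠ decide (Odd (b (i + 1)))) :
    ∀ i ≤ j, b 0 + i ≤ b i := by
  intro i
  induction i with
  | zero => simp
  | succ i ih =>
    intro hi
    have h1 := ih (by omega)
    have h2 := hm i (by omega)
    have h3 := hc i (by omega)
    have : b i ≠ b (i + 1) := fun h => h3 (by rw [h])
    omega

/-- The first point of a violation has value `1`, hence rank at least `1`, and each of the `k` steps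
raises the rank, so the last rank would exceed `k`. -/
theorem mem_kMonotone_of_rank {k : ℕ} {f : BoolFun n} {ρ : Cube n → ℕ} (hρ : Monotone ρ)
    (hk : ∀ x, ρ x ≤ k) (hf : ∀ x, f x = decide (Odd (ρ x))) : f ∈ kMonotone n k := by
  rintro ⟨x, hx, h0, hc⟩
  have key := add_le_of_parity_changes (j := k)
    (b := fun i => if h : i < k + 1 then ρ (x ⟨i, h⟩) else 0) ?_ ?_ k le_rfl
  · have h1 := hk (x ⟨k, by omega⟩)
    rw [hf] at h0
    have h2 : 1 ≤ ρ (x 0) := by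
      have : Odd (ρ (x 0)) := by simpa using h0
      exact this.pos
    simp at key
    change ρ (x 0) + k ≤ _ at key
    omega
  · intro i hi
    simp only [show i < k + 1 by omega, show i + 1 < k + 1 by omega, dif_pos]
    exact hρ (hx.monotone (Fin.mk_le_mk.2 (by omega)))
  · intro i hi
    simp only [show i < k + 1 by omega, show i + 1 < k + 1 by omega, dif_pos]
    have := hc ⟨i, hi⟩
    rw [hf, hf] at this
    exact this

/-! ### One-sided testers must find violations -/

/-- The queries of `A` contain a violation of `k`-monotonicity of `f`. -/
def DetNonadaptive.Finds {q : ℕ} (A : DetNonadaptive n q) (k : ℕ) (f : BoolFun n) : Prop :=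
  ∃ x : Fin (k + 1) → Cube n, (∀ i, x i ∈ Set.range A.query) ∧ IsViolation f x

/-- A one-sided tester can reject only if its queries contain a violation. -/
theorem IsOneSidedTester.finds_of_run_eq_false {q k l : ℕ} {ε : ℝ} {T : RandNonadaptive n q}
    (hT : IsOneSidedTester k l ε T) {f : BoolFun n} {A : DetNonadaptive n q} (hA : A ∈ T.support)
    (hr : A.run f = false) : A.Finds k f := by
  by_contra h
  obtain ⟨ρ, hρ, hk, hf⟩ := exists_rank h
  -- This `k`-monotone function agrees with `f` on the queries, so `A` would reject it too.
  have h1 := hT.1 (fun x => decide (Odd (ρ x))) (mem_kMonotone_of_rank hρ hk fun _ => rfl)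
  have h2 : A.run (fun x => decide (Odd (ρ x))) = false := by
    rw [← hr]
    unfold DetNonadaptive.run
    congr 1
    funext i
    exact (hf _ ⟨i, rfl⟩).symm
  have h3 : false ∈ (RandNonadaptive.outputDist T (fun x => decide (Odd (ρ x)))).support := by
    unfold RandNonadaptive.outputDist
    rw [PMF.mem_support_map_iff]
    exact ⟨A, hA, h2⟩
  rw [PMF.apply_eq_one_iff] at h1
  rw [h1] at h3
  simp at h3

open Classical in
/-- On a far function, the queries of a one-sided tester contain a violation with probability at
least `2/3`. -/
theorem IsOneSidedTester.two_thirds_le_finds {q k l : ℕ} {ε : ℝ} {T : RandNonadaptive n q}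
    (hT : IsOneSidedTester k l ε T) {f : BoolFun n} (hf : ε < distTo f (kMonotone n l)) :
    2 / 3 ≤ ∑' A, if A.Finds k f then T A else 0 := by
  refine (hT.2 f hf).trans ?_
  unfold RandNonadaptive.outputDist
  rw [PMF.map_apply]
  refine ENNReal.tsum_le_tsum fun A => ?_
  split_ifs with h1 h2 h2
  · exact le_rfl
  · by_cases hA : A ∈ T.support
    · exact absurd (hT.finds_of_run_eq_false hA h1.symm) h2
    · rw [PMF.mem_support_iff, not_not] at hA
      exact hA.le
  · exact zero_le
  · exact le_rfl

open Classical in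
/-- If every query set finds violations in at most `N` members of a finite family of far functions,
then `2/3` of the size of the family is at most `N`. -/
theorem IsOneSidedTester.two_thirds_card_le {q k l : ℕ} {ε : ℝ} {T : RandNonadaptive n q}
    (hT : IsOneSidedTester k l ε T) {ι : Type*} (s : Finset ι) (f : ι → BoolFun n) (N : ℕ)
    (hf : ∀ a ∈ s, ε < distTo (f a) (kMonotone n l))
    (hN : ∀ A : DetNonadaptive n q, (s.filter fun a => A.Finds k (f a)).card ≤ N) :
    2 * s.card ≤ 3 * N := by
  have h1 : ∑ _a ∈ s, (2 / 3 : ENNReal) ≤ ∑ a ∈ s, ∑' A, if A.Finds k (f a) then T A else 0 :=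
    Finset.sum_le_sum fun a ha => hT.two_thirds_le_finds (hf a ha)
  -- Exchange the sums: each outcome of the coins catches at most `N` members.
  rw [← Summable.tsum_finsetSum (fun _ _ => ENNReal.summable)] at h1
  have h2 : ∑' A, (∑ a ∈ s, if A.Finds k (f a) then T A else 0) ≤ ∑' A, (N : ENNReal) * T A := by
    refine ENNReal.tsum_le_tsum fun A => ?_
    rw [← Finset.sum_filter, Finset.sum_const, nsmul_eq_mul]
    gcongr
    exact hN A
  rw [ENNReal.tsum_mul_left, T.tsum_coe, mul_one] at h2
  have h3 := h1.trans h2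
  rw [Finset.sum_const, nsmul_eq_mul] at h3
  have h4 := ENNReal.toReal_mono (by simp) h3
  simp only [ENNReal.toReal_mul, ENNReal.toReal_div, ENNReal.toReal_natCast,
    ENNReal.toReal_ofNat] at h4
  have h5 : (2 * s.card : ℝ) ≤ 3 * N := by linarith
  exact_mod_cast h5

/-! ### Intersections of a random set with a fixed set -/

/-- Each factor `(a - i) / (n - i)` of the quotient of the binomial coefficients is at most `a / n`.
-/
theorem choose_mul_pow_le_pow_mul_choose {a n : ℕ} (h : a ≤ n) (t : ℕ) :
    a.choose t * n ^ t ≤ a ^ t * n.choose t := by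
  induction t with
  | zero => simp
  | succ t ih =>
    refine Nat.le_of_mul_le_mul_right (c := t + 1) ?_ (Nat.succ_pos t)
    have h1 : (a - t) * n ≤ a * (n - t) := by
      rw [Nat.sub_mul, Nat.mul_sub]
      have : t * a ≤ t * n := Nat.mul_le_mul_left t h
      rw [Nat.mul_comm a t]
      omega
    calc a.choose (t + 1) * n ^ (t + 1) * (t + 1)
        = (a.choose (t + 1) * (t + 1)) * n ^ t * n := by ring
      _ = (a.choose t * n ^ t) * ((a - t) * n) := by rw [Nat.choose_succ_right_eq]; ring
      _ ≤ (a ^ t * n.choose t) * (a * (n - t)) := Nat.mul_le_mul ih h1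
      _ = a ^ (t + 1) * (n.choose t * (n - t)) := by ring
      _ = a ^ (t + 1) * n.choose (t + 1) * (t + 1) := by rw [← Nat.choose_succ_right_eq]; ring

/-- Bounds by `(a / n) ^ t` the probability that a random `a`-set contains a given `t`-set. -/
theorem choose_sub_mul_pow_le {a n t : ℕ} (h : a ≤ n) (ht : t ≤ a) :
    (n - t).choose (a - t) * n ^ t ≤ a ^ t * n.choose a := by
  refine le_of_mul_le_mul_left (a := n.choose t) ?_ (Nat.choose_pos (ht.trans h))
  calc n.choose t * ((n - t).choose (a - t) * n ^ t)
      = n.choose a * (a.choose t * n ^ t) := by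
        rw [← Nat.mul_assoc, ← Nat.choose_mul ht, Nat.mul_assoc]
    _ ≤ n.choose a * (a ^ t * n.choose t) :=
        Nat.mul_le_mul_left _ (choose_mul_pow_le_pow_mul_choose h t)
    _ = n.choose t * (a ^ t * n.choose a) := by ring

section SubsetCount

variable {α : Type*} [Fintype α] [DecidableEq α]

theorem card_powersetCard_filter_superset_le (T : Finset α) (a : ℕ) :
    ((Finset.powersetCard a (Finset.univ : Finset α)).filter fun A => T ⊆ A).card
      ≤ (Fintype.card α - T.card).choose (a - T.card) := by
  rw [← Finset.card_compl, ← Finset.card_powersetCard]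
  refine Finset.card_le_card_of_injOn (fun A => A \ T) ?_ ?_
  · intro A hA
    rw [Finset.mem_coe, Finset.mem_filter, Finset.mem_powersetCard] at hA
    rw [Finset.mem_coe, Finset.mem_powersetCard]
    refine ⟨fun i hi => ?_, by rw [Finset.card_sdiff_of_subset hA.2, hA.1.2]⟩
    simp only [Finset.mem_sdiff] at hi
    simpa using hi.2
  · intro A hA B hB hAB
    rw [Finset.mem_coe, Finset.mem_filter] at hA hB
    dsimp only at hAB
    rw [← Finset.sdiff_union_of_subset hA.2, ← Finset.sdiff_union_of_subset hB.2, hAB]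

/-- Union bound over the `t`-subsets of `D`. -/
theorem card_powersetCard_filter_le_card_inter_le (D : Finset α) (a t : ℕ) :
    ((Finset.powersetCard a (Finset.univ : Finset α)).filter fun A => t ≤ (A ∩ D).card).card
      ≤ D.card.choose t * (Fintype.card α - t).choose (a - t) := by
  have hsub : ((Finset.powersetCard a (Finset.univ : Finset α)).filter
      fun A => t ≤ (A ∩ D).card) ⊆ (Finset.powersetCard t D).biUnion fun T =>
        (Finset.powersetCard a (Finset.univ : Finset α)).filter fun A => T ⊆ A := by
    intro A hA
    rw [Finset.mem_filter] at hA
    obtain ⟨T, hT, hc⟩ := Finset.exists_subset_card_eq hA.2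
    rw [Finset.mem_biUnion]
    exact ⟨T, Finset.mem_powersetCard.2 ⟨hT.trans Finset.inter_subset_right, hc⟩,
      Finset.mem_filter.2 ⟨hA.1, hT.trans Finset.inter_subset_left⟩⟩
  refine (Finset.card_le_card hsub).trans ?_
  rw [← Finset.card_powersetCard]
  refine Finset.card_biUnion_le_card_mul _ _ _ fun T hT => ?_
  have h := card_powersetCard_filter_superset_le T a
  rwa [(Finset.mem_powersetCard.1 hT).2] at h

/-- A random set of size `a` is unlikely to meet a set `D` in at least `t` elements when `t` is
several times the expected size `|D| a / n` of the intersection. -/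
theorem card_filter_large_inter_le_exp (D : Finset α) {a t : ℕ} (ht : 0 < t)
    (hn : 0 < Fintype.card α) (ha : a ≤ Fintype.card α)
    (h : 8 * (D.card * a) ≤ Fintype.card α * t) :
    (((Finset.powersetCard a (Finset.univ : Finset α)).filter
      fun A => t ≤ (A ∩ D).card).card : ℝ)
      ≤ Real.exp (-t) * (Fintype.card α).choose a := by
  set n := Fintype.card α
  rcases lt_or_ge a t with hat | hta
  · rw [Finset.filter_false_of_mem]
    · simp only [Finset.card_empty, Nat.cast_zero]; positivity
    · intro A hA
      have h1 := Finset.card_le_card (Finset.inter_subset_left (s₁ := A) (s₂ := D))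
      rw [(Finset.mem_powersetCard.1 hA).2] at h1
      omega
  set N := ((Finset.powersetCard a (Finset.univ : Finset α)).filter
      fun A => t ≤ (A ∩ D).card).card
  have h1 : (N : ℝ) ≤ (D.card.choose t : ℝ) * ((n - t).choose (a - t) : ℕ) := by
    exact_mod_cast card_powersetCard_filter_le_card_inter_le D a t
  have h2 : (((n - t).choose (a - t) : ℕ) : ℝ) * n ^ t ≤ a ^ t * n.choose a := by
    exact_mod_cast choose_sub_mul_pow_le ha hta
  have h3 : (D.card.choose t : ℝ) * t ^ t ≤ D.card ^ t * Real.exp t := by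
    have h4 : (D.card.choose t : ℝ) ≤ (D.card : ℝ) ^ t / t.factorial :=
      Nat.choose_le_pow_div t D.card
    have h5 : (t : ℝ) ^ t / t.factorial ≤ Real.exp t :=
      Real.pow_div_factorial_le_exp t (by positivity) t
    calc (D.card.choose t : ℝ) * t ^ t ≤ (D.card : ℝ) ^ t / t.factorial * t ^ t := by gcongr
      _ = (D.card : ℝ) ^ t * ((t : ℝ) ^ t / t.factorial) := by ring
      _ ≤ _ := by gcongr
  -- One factor `e` comes from `C(d, t) ≤ (e d / t) ^ t`, the other produces the gain `exp (-t)`.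
  have he : Real.exp 2 ≤ 8 := by
    have := Real.exp_one_lt_d9
    rw [show (2 : ℝ) = 1 + 1 by norm_num, Real.exp_add]
    nlinarith [Real.exp_pos 1]
  have h6 : ((D.card : ℝ) * Real.exp 2 * a) ≤ n * t := by
    have : (8 * (D.card * a) : ℝ) ≤ n * t := by exact_mod_cast h
    have h0 : (0 : ℝ) ≤ D.card * a := by positivity
    nlinarith
  have h7 : ((D.card : ℝ) * Real.exp 2 * a) ^ t ≤ (n * t : ℝ) ^ t := by gcongr
  have h8 : (0 : ℝ) < (n * t : ℝ) ^ t := by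
    have : (0 : ℝ) < n := by exact_mod_cast hn
    positivity
  refine le_of_mul_le_mul_right ?_ h8
  calc (N : ℝ) * (n * t : ℝ) ^ t
      ≤ ((D.card.choose t : ℝ) * ((n - t).choose (a - t) : ℕ)) * (n * t : ℝ) ^ t := by gcongr
    _ = ((D.card.choose t : ℝ) * t ^ t) * ((((n - t).choose (a - t) : ℕ) : ℝ) * n ^ t) := by
        rw [mul_pow]; ring
    _ ≤ (D.card ^ t * Real.exp t) * (a ^ t * n.choose a) := by gcongr
    _ = Real.exp (-t) * n.choose a * ((D.card : ℝ) * Real.exp 2 * a) ^ t := by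
        rw [mul_pow, mul_pow, ← Real.exp_nat_mul, Real.exp_neg]
        have : Real.exp (t * 2) = Real.exp t * Real.exp t := by rw [← Real.exp_add]; ring_nf
        rw [this]
        field_simp
    _ ≤ Real.exp (-t) * n.choose a * (n * t : ℝ) ^ t := by gcongr

end SubsetCount

/-! ### The hard functions and their violations -/

/-- The number of ones of `x` in the coordinates of `A`. -/
def weightOn (A : Finset (Fin n)) (x : Cube n) : ℕ := (A.filter fun i => x i = true).card

theorem weightOn_mono (A : Finset (Fin n)) : Monotone (weightOn A) := by
  intro x y h
  refine Finset.card_le_card fun i hi => ?_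
  rw [Finset.mem_filter] at hi ⊢
  exact ⟨hi.1, le_antisymm le_top (hi.2 ▸ h i)⟩

theorem weightOn_sub (A : Finset (Fin n)) {x y : Cube n} (h : x ≤ y) :
    weightOn A x + (A ∩ Finset.univ.filter fun i => y i = true ∧ x i = false).card
      = weightOn A y := by
  unfold weightOn
  rw [← Finset.card_union_of_disjoint]
  · congr 1
    ext i
    have hi := h i
    simp only [Finset.mem_union, Finset.mem_filter, Finset.mem_inter, Finset.mem_univ, true_and]
    cases hx : x i <;> cases hy : y i <;> simp_all [Bool.le_iff_imp]
  · rw [Finset.disjoint_left]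
    intro i h1 h2
    simp_all

/-- The Hamming weight of `x` is within `2 √n` of `n / 2`. -/
def IsMiddle (x : Cube n) : Prop :=
  (2 * (weightOn Finset.univ x : ℤ) - n) ^ 2 ≤ 16 * n

instance (x : Cube n) : Decidable (IsMiddle x) := by unfold IsMiddle; infer_instance

theorem IsMiddle.of_between {x y z : Cube n} (hx : IsMiddle x) (hz : IsMiddle z) (hxy : x ≤ y)
    (hyz : y ≤ z) : IsMiddle y := by
  unfold IsMiddle at *
  have h1 : (weightOn Finset.univ x : ℤ) ≤ weightOn Finset.univ y := by
    exact_mod_cast weightOn_mono _ hxy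
  have h2 : (weightOn Finset.univ y : ℤ) ≤ weightOn Finset.univ z := by
    exact_mod_cast weightOn_mono _ hyz
  rcases le_total 0 (2 * (weightOn Finset.univ y : ℤ) - n) with h | h <;> nlinarith

theorem IsMiddle.weightOn_sub_le {x y : Cube n} (hx : IsMiddle x) (hy : IsMiddle y) :
    (weightOn Finset.univ y : ℝ) - weightOn Finset.univ x ≤ 4 * Real.sqrt n := by
  unfold IsMiddle at *
  have hx' : (2 * (weightOn Finset.univ x : ℝ) - n) ^ 2 ≤ (4 * Real.sqrt n) ^ 2 := by
    rw [mul_pow, Real.sq_sqrt (by positivity)]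
    have : (2 * (weightOn Finset.univ x : ℝ) - n) ^ 2 ≤ 16 * n := by exact_mod_cast hx
    linarith
  have hy' : (2 * (weightOn Finset.univ y : ℝ) - n) ^ 2 ≤ (4 * Real.sqrt n) ^ 2 := by
    rw [mul_pow, Real.sq_sqrt (by positivity)]
    have : (2 * (weightOn Finset.univ y : ℝ) - n) ^ 2 ≤ 16 * n := by exact_mod_cast hy
    linarith
  have h1 := abs_le_of_sq_le_sq' hx' (by positivity)
  have h2 := abs_le_of_sq_le_sq' hy' (by positivity)
  linarith [h1.1, h2.2]

/-- On the middle layers, the parity of the block of length `w` that contains the weight on `A`,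
shifted by `K`; outside the middle layers, `0`. -/
def blockParity (A : Finset (Fin n)) (w K : ℕ) : BoolFun n :=
  fun x => decide (IsMiddle x ∧ Odd ((weightOn A x + K) / w))

theorem isMiddle_of_blockParity_eq_true {A : Finset (Fin n)} {w K : ℕ} {x : Cube n}
    (h : blockParity A w K x = true) : IsMiddle x :=
  (of_decide_eq_true h).1

/-- A violation of `k`-monotonicity of `blockParity A w K` contains two points of the middle layers
whose difference has many elements in `A`. -/
theorem IsViolation.exists_large_inter {k : ℕ} {A : Finset (Fin n)} {w K : ℕ} (hw : 0 < w)
    {x : Fin (k + 1) → Cube n} (hx : IsViolation (blockParity A w K) x) :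
    ∃ i j, x i ≤ x j ∧ IsMiddle (x i) ∧ IsMiddle (x j) ∧
      w * (2 * (k / 2) - 1) ≤
        (A ∩ Finset.univ.filter fun l => x j l = true ∧ x i l = false).card := by
  obtain ⟨hmono, h0, hc⟩ := hx
  have hval : ∀ i (hi : i < k + 1), blockParity A w K (x ⟨i, hi⟩) = decide (Even i) := by
    intro i
    induction i with
    | zero => intro hi; simpa using h0
    | succ i ih =>
      intro hi
      have h1 := ih (by omega)
      have h2 := hc ⟨i, by omega⟩
      change blockParity A w K (x ⟨i, by omega⟩) ≠ blockParity A w K (x ⟨i + 1, hi⟩) at h2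
      rw [h1] at h2
      by_cases he : Even i <;> simp [he, Nat.even_add_one] at h2 ⊢ <;> simpa using h2.symm
  -- Points of even index have value `1`, so they are in the middle layers. The last point need not
  -- be when `k` is odd, hence the last even index.
  have hj : 2 * (k / 2) < k + 1 := by omega
  have hm0 : IsMiddle (x 0)  :=
    isMiddle_of_blockParity_eq_true h0
  have hmj : IsMiddle (x ⟨2 * (k / 2), hj⟩)  :=
    isMiddle_of_blockParity_eq_true (by simpa using hval _ hj)
  have h0j : x 0 ≤ x ⟨2 * (k / 2), hj⟩ := hmono.monotone (Fin.zero_le _)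
  refine ⟨0, ⟨2 * (k / 2), hj⟩, h0j, hm0, hmj, ?_⟩
  have key := add_le_of_parity_changes (j := 2 * (k / 2))
    (b := fun i => if h : i < k + 1 then (weightOn A (x ⟨i, h⟩) + K) / w else 0) ?_ ?_ _ le_rfl
  · simp only [hj, dif_pos, Nat.succ_pos] at key
    change (weightOn A (x 0) + K) / w + _ ≤ _ at key
    have h1 := weightOn_sub A h0j
    have h2 := Nat.div_mul_le_self (weightOn A (x ⟨2 * (k / 2), hj⟩) + K) w
    -- One block is lost: the first weight may be at the end of its block and the last at the start.
    have h3 := Nat.lt_div_mul_add hw (a := weightOn A (x 0) + K)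
    have h4 := Nat.mul_le_mul_right w key
    rw [Nat.add_mul] at h4
    rw [Nat.mul_sub, Nat.mul_one, Nat.mul_comm w]
    omega
  · intro i hi
    simp only [show i < k + 1 by omega, show i + 1 < k + 1 by omega, dif_pos]
    gcongr
    exact weightOn_mono A (hmono.monotone (Fin.mk_le_mk.2 (by omega)))
  · intro i hi
    simp only [show i < k + 1 by omega, show i + 1 < k + 1 by omega, dif_pos]
    have hmid : ∀ l (hl : l < k + 1), l ≤ 2 * (k / 2) → IsMiddle (x ⟨l, hl⟩) := fun l hl hl' =>
      hm0.of_between hmj (hmono.monotone (Fin.zero_le _))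
        (hmono.monotone (Fin.mk_le_mk.2 hl'))
    have h1 := hc ⟨i, by omega⟩
    change blockParity A w K (x ⟨i, by omega⟩) ≠ blockParity A w K (x ⟨i + 1, by omega⟩) at h1
    unfold blockParity at h1
    simpa only [hmid i (by omega) (by omega), hmid (i + 1) (by omega) (by omega),
      true_and] using h1

open Classical in
/-- A fixed set of `q` queries finds a violation in few of the functions `blockParity A w K`. -/
theorem DetNonadaptive.card_finds_blockParity_le {q k a w K : ℕ} (hn : 0 < n) (hw : 0 < w)
    (hk : 2 ≤ k) (ha : a ≤ n)
    (h : 32 * (a : ℝ) ≤ Real.sqrt n * (w * (2 * (k / 2) - 1) : ℕ)) (B : DetNonadaptive n q) :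
    (((Finset.powersetCard a (Finset.univ : Finset (Fin n))).filter
      fun A => B.Finds k (blockParity A w K)).card : ℝ)
      ≤ q ^ 2 * (Real.exp (-(w * (2 * (k / 2) - 1) : ℕ)) * n.choose a) := by
  set t := w * (2 * (k / 2) - 1) with ht
  have ht0 : 0 < t := Nat.mul_pos hw (by omega)
  let D : Fin q × Fin q → Finset (Fin n) := fun p =>
    Finset.univ.filter fun l => B.query p.2 l = true ∧ B.query p.1 l = false
  -- The pairs to which the tail bound applies; all comparable pairs in the middle layers are among
  -- them.
  let P : Finset (Fin q × Fin q) := Finset.univ.filter fun p => 8 * ((D p).card * a) ≤ n * t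
  have hsub : ((Finset.powersetCard a (Finset.univ : Finset (Fin n))).filter
      fun A => B.Finds k (blockParity A w K)) ⊆ P.biUnion fun p =>
        (Finset.powersetCard a (Finset.univ : Finset (Fin n))).filter
          fun A => t ≤ (A ∩ D p).card := by
    intro A hA
    rw [Finset.mem_filter] at hA
    obtain ⟨x, hxQ, hx⟩ := hA.2
    obtain ⟨i, j, hij, hi, hj, hc⟩ := hx.exists_large_inter hw
    obtain ⟨i', hi'⟩ := hxQ i
    obtain ⟨j', hj'⟩ := hxQ j
    rw [← hi'] at hij hi hc
    rw [← hj'] at hij hj hc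
    refine Finset.mem_biUnion.2 ⟨(i', j'), Finset.mem_filter.2 ⟨Finset.mem_univ _, ?_⟩,
      Finset.mem_filter.2 ⟨hA.1, hc⟩⟩
    have h1 := weightOn_sub Finset.univ hij
    rw [Finset.univ_inter] at h1
    have h2 := hi.weightOn_sub_le hj
    rw [← h1] at h2
    have h3 : ((D (i', j')).card : ℝ) ≤ 4 * Real.sqrt n := by push_cast at h2; linarith
    have h4 : (8 * ((D (i', j')).card * a) : ℝ) ≤ n * t := by
      have hs := Real.sq_sqrt (Nat.cast_nonneg (α := ℝ) n)
      calc (8 * ((D (i', j')).card * a) : ℝ) ≤ 8 * (4 * Real.sqrt n * a) := by gcongr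
        _ = Real.sqrt n * (32 * a) := by ring
        _ ≤ Real.sqrt n * (Real.sqrt n * t) := by gcongr
        _ = n * t := by rw [← mul_assoc, ← sq, hs]
    exact_mod_cast h4
  have h1 : (((Finset.powersetCard a (Finset.univ : Finset (Fin n))).filter
      fun A => B.Finds k (blockParity A w K)).card : ℝ) ≤ ∑ p ∈ P,
        (((Finset.powersetCard a (Finset.univ : Finset (Fin n))).filter
          fun A => t ≤ (A ∩ D p).card).card : ℝ) := by
    exact_mod_cast (Finset.card_le_card hsub).trans Finset.card_biUnion_le
  refine h1.trans ?_
  have h2 : ∀ p ∈ P, (((Finset.powersetCard a (Finset.univ : Finset (Fin n))).filter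
          fun A => t ≤ (A ∩ D p).card).card : ℝ) ≤ Real.exp (-t) * n.choose a := by
    intro p hp
    have h3 := card_filter_large_inter_le_exp (D p) ht0 (by simpa using hn) (a := a)
      (by simpa using ha) (by simpa using (Finset.mem_filter.1 hp).2)
    simpa using h3
  refine (Finset.sum_le_card_nsmul _ _ _ h2).trans ?_
  rw [nsmul_eq_mul]
  have h4 : (P.card : ℝ) ≤ q ^ 2 := by
    have : P.card ≤ q ^ 2 := (Finset.card_le_univ P).trans (by simp [sq])
    exact_mod_cast this
  gcongr

/-! ### Binomial coefficients near the middle -/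

/-- The bound `4 ^ m / (2 √m)` for the central coefficient, squared; the induction rests on `4m(m +
1) ≤ (2m + 1)²`. -/
theorem sixteen_pow_le_mul_centralBinom_sq {m : ℕ} (hm : 1 ≤ m) :
    16 ^ m ≤ 4 * m * m.centralBinom ^ 2 := by
  induction m, hm using Nat.le_induction with
  | base => simp [Nat.centralBinom]
  | succ m hm ih =>
    refine le_of_mul_le_mul_left (a := m + 1) ?_ (Nat.succ_pos m)
    calc (m + 1) * 16 ^ (m + 1) = 16 * (m + 1) * 16 ^ m := by ring
      _ ≤ 16 * (m + 1) * (4 * m * m.centralBinom ^ 2) := Nat.mul_le_mul_left _ ih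
      _ = 16 * (4 * m * (m + 1)) * m.centralBinom ^ 2 := by ring
      _ ≤ 16 * (2 * m + 1) ^ 2 * m.centralBinom ^ 2 := by
        gcongr
        nlinarith
      _ = 4 * (2 * (2 * m + 1) * m.centralBinom) ^ 2 := by ring
      _ = 4 * ((m + 1) * (m + 1).centralBinom) ^ 2 := by rw [Nat.succ_mul_centralBinom_succ]
      _ = (m + 1) * (4 * (m + 1) * (m + 1).centralBinom ^ 2) := by ring

/-- Consecutive coefficients have ratio `(m - j) / (m + j + 1)`, so `j` steps from the middle lose
at most the fraction `j² / m`. -/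
theorem sub_sq_mul_centralBinom_le {m j : ℕ} (hj : j ≤ m) :
    ((m : ℝ) - j ^ 2) * m.centralBinom ≤ m * (2 * m).choose (m + j) := by
  induction j with
  | zero => simp [Nat.centralBinom]
  | succ j ih =>
    have h1 := ih (by omega)
    have hjm : (j : ℝ) + 1 ≤ m := by exact_mod_cast hj
    have h2 : ((2 * m).choose (m + j + 1) : ℝ) * (m + j + 1) = (2 * m).choose (m + j) * (m - j) := by
      have h3 := Nat.choose_succ_right_eq (2 * m) (m + j)
      have h4 : 2 * m - (m + j) = m - j := by omega
      rw [h4] at h3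
      have h5 : ((m - j : ℕ) : ℝ) = m - j := Nat.cast_sub (by omega)
      rw [← h5]
      exact_mod_cast h3
    have hpos : (0 : ℝ) < m + j + 1 := by positivity
    refine le_of_mul_le_mul_right ?_ hpos
    have hcb : (0 : ℝ) ≤ m.centralBinom := by positivity
    have h6 : ((m : ℝ) - ((j : ℝ) + 1) ^ 2) * (m + j + 1) ≤ ((m : ℝ) - j ^ 2) * (m - j) := by
      nlinarith [sq_nonneg (j : ℝ), (Nat.cast_nonneg j : (0 : ℝ) ≤ j),
        mul_nonneg (Nat.cast_nonneg j : (0 : ℝ) ≤ j) (sq_nonneg (j : ℝ))]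
    calc ((m : ℝ) - ((j + 1 : ℕ) : ℝ) ^ 2) * m.centralBinom * (m + j + 1)
        = ((m : ℝ) - ((j : ℝ) + 1) ^ 2) * (m + j + 1) * m.centralBinom := by push_cast; ring
      _ ≤ ((m : ℝ) - j ^ 2) * (m - j) * m.centralBinom := by gcongr
      _ = ((m : ℝ) - j ^ 2) * m.centralBinom * (m - j) := by ring
      _ ≤ m * (2 * m).choose (m + j) * (m - j) := by
        gcongr
        linarith
      _ = m * (2 * m).choose (m + (j + 1)) * (m + j + 1) := by
        rw [mul_assoc, ← h2, ← Nat.add_assoc]; ring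

/-- The layers of a cube of dimension `2m` near the middle one have at least a constant times
`4 ^ m / √m` points. -/
theorem four_pow_le_mul_choose {m u : ℕ} (hm : 1 ≤ m) (hu : m ≤ u) (h : 2 * (u - m) ^ 2 ≤ m) :
    (4 : ℝ) ^ m ≤ 4 * Real.sqrt m * (2 * m).choose u := by
  obtain ⟨j, rfl⟩ := Nat.exists_eq_add_of_le hu
  rw [Nat.add_sub_cancel_left] at h
  have hj : j ≤ m := by nlinarith
  have hm0 : (0 : ℝ) < m := by exact_mod_cast hm
  have h1 := sub_sq_mul_centralBinom_le hj
  have h2 : (m.centralBinom : ℝ) ≤ 2 * (2 * m).choose (m + j) := by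
    have h3 : (2 * (j : ℝ) ^ 2) ≤ m := by exact_mod_cast h
    refine le_of_mul_le_mul_left ?_ hm0
    have hcb : (0 : ℝ) ≤ m.centralBinom := by positivity
    nlinarith
  have h3 : (4 : ℝ) ^ m ≤ 2 * Real.sqrt m * m.centralBinom := by
    refine le_of_sq_le_sq ?_ (by positivity)
    rw [mul_pow, mul_pow, Real.sq_sqrt hm0.le, ← pow_mul, mul_comm m 2, pow_mul]
    norm_num
    exact_mod_cast sixteen_pow_le_mul_centralBinom_sq hm
  calc (4 : ℝ) ^ m ≤ 2 * Real.sqrt m * m.centralBinom := h3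
    _ ≤ 2 * Real.sqrt m * (2 * (2 * m).choose (m + j)) := by gcongr
    _ = _ := by ring

/-! ### Errors on one slice, by averaging over maximal chains -/

/-- The parity of a monotone function with values at most `g` disagrees often with a function that
alternates on blocks of length `w`. -/
theorem le_card_parity_ne_block_add {r : ℕ → ℕ} (hr : Monotone r) {w K m : ℕ} (hw : 0 < w)
    (hK : 2 * w ∣ m + K) (p : ℕ) :
    w * p + w * r m ≤ ((Finset.Ico m (m + 2 * w * p)).filter
      fun u => ¬ (Odd (r u) ↔ Odd ((u + K) / w))).card + w * r (m + 2 * w * p) := by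
  induction p with
  | zero => simp
  | succ p ih =>
    set M := m + 2 * w * p with hM
    have hM' : m + 2 * w * (p + 1) = M + 2 * w := by rw [hM]; ring
    rw [hM']
    have hsplit : (Finset.Ico m (M + 2 * w)).filter (fun u => ¬ (Odd (r u) ↔ Odd ((u + K) / w))) =
        (Finset.Ico m M).filter (fun u => ¬ (Odd (r u) ↔ Odd ((u + K) / w))) ∪
        (Finset.Ico M (M + 2 * w)).filter (fun u => ¬ (Odd (r u) ↔ Odd ((u + K) / w))) := by
      rw [← Finset.filter_union, Finset.Ico_union_Ico_eq_Ico (by omega) (by omega)]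
    have hdisj : Disjoint
        ((Finset.Ico m M).filter (fun u => ¬ (Odd (r u) ↔ Odd ((u + K) / w))))
        ((Finset.Ico M (M + 2 * w)).filter (fun u => ¬ (Odd (r u) ↔ Odd ((u + K) / w)))) :=
      Finset.disjoint_filter_filter (Finset.Ico_disjoint_Ico_consecutive _ _ _)
    rw [hsplit, Finset.card_union_of_disjoint hdisj]
    have hmono : r M ≤ r (M + 2 * w) := hr (by omega)
    -- A rise of `r` pays for its double block through the term `w * r`; only constant `r` remains.
    suffices H : r M = r (M + 2 * w) →
        w ≤ ((Finset.Ico M (M + 2 * w)).filter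
          (fun u => ¬ (Odd (r u) ↔ Odd ((u + K) / w)))).card by
      rw [Nat.mul_add, Nat.mul_one]
      rcases eq_or_lt_of_le hmono with h | h
      · have := H h
        rw [← h]
        omega
      · have := Nat.mul_le_mul_left w (Nat.succ_le_of_lt h)
        rw [Nat.mul_succ] at this
        omega
    intro h
    have hconst : ∀ u ∈ Finset.Ico M (M + 2 * w), r u = r M := by
      intro u hu
      rw [Finset.mem_Ico] at hu
      exact le_antisymm (h ▸ hr hu.2.le) (hr hu.1)
    obtain ⟨c, hc⟩ : 2 * w ∣ M + K := by
      rw [hM, Nat.add_right_comm]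
      exact dvd_add hK (dvd_mul_right _ _)
    have hdiv : ∀ b v, v < w → (M + b * w + v + K) / w = 2 * c + b := by
      intro b v hv
      have : M + b * w + v + K = v + w * (2 * c + b) := by
        rw [show M + b * w + v + K = (M + K) + b * w + v by ring, hc]; ring
      rw [this, Nat.add_mul_div_left _ _ hw, Nat.div_eq_of_lt hv, Nat.zero_add]
    -- The two blocks have indices `2c` and `2c + 1`, so one of them has the wrong parity
    -- throughout.
    obtain ⟨b, hb, hbo⟩ : ∃ b, b < 2 ∧ ¬ (Odd (r M) ↔ Odd (2 * c + b)) := by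
      by_cases ho : Odd (r M)
      · refine ⟨0, by omega, ?_⟩
        simp [ho]
      · refine ⟨1, by omega, ?_⟩
        simp [ho]
    have hbw : b * w ≤ w := by interval_cases b <;> omega
    have hsub : Finset.Ico (M + b * w) (M + b * w + w) ⊆ (Finset.Ico M (M + 2 * w)).filter
          (fun u => ¬ (Odd (r u) ↔ Odd ((u + K) / w))) := by
      intro u hu
      rw [Finset.mem_Ico] at hu
      have hu' : u ∈ Finset.Ico M (M + 2 * w) := by
        rw [Finset.mem_Ico]; omega
      refine Finset.mem_filter.2 ⟨hu', ?_⟩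
      obtain ⟨v, rfl⟩ := Nat.exists_eq_add_of_le hu.1
      rwa [hconst _ hu', hdiv b v (by omega)]
    simpa using Finset.card_le_card hsub

section Slice

variable {ι : Type*} [Fintype ι] [DecidableEq ι]

/-- The sets near the middle layer whose image under the parity of `ρ` differs from the parity of
the block of length `w` that contains their size. -/
def blockErrors (ρ : Finset ι → ℕ) (m w K p : ℕ) : Finset (Finset ι) :=
  Finset.univ.filter fun S => (m ≤ S.card ∧ S.card < m + 2 * w * p) ∧
    ¬ (Odd (ρ S) ↔ Odd ((S.card + K) / w))

/-- The prefixes of `e` form a maximal chain with one set of each size, so the count for functions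
of the size applies. -/
theorem le_card_prefix_blockErrors {ρ : Finset ι → ℕ} (hρ : Monotone ρ) {g m w K p : ℕ}
    (hg : ∀ S, ρ S ≤ g) (hι : Fintype.card ι = 2 * m) (hw : 0 < w) (hK : 2 * w ∣ m + K)
    (hp : 2 * w * p ≤ m) (e : Numbering ι) :
    w * p ≤ ((blockErrors ρ m w K p).filter fun S => Numbering.IsPrefix e S).card + w * g := by
  let S : ℕ → Finset ι := fun u => Finset.univ.filter fun i => (e i : ℕ) < u
  have hS : Monotone S := by
    intro u v huv i hi
    simp only [S, Finset.mem_filter, Finset.mem_univ, true_and] at hi ⊢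
    omega
  have hcard : ∀ u ≤ 2 * m, (S u).card = u := by
    intro u hu
    have h1 : (S u).card = (Finset.univ.filter
        fun i : Fin (Fintype.card ι) => (i : ℕ) < u).card := by
      refine Finset.card_bij (fun i _ => e i) ?_ ?_ ?_
      · intro i hi; simpa [S] using hi
      · intro i _ j _ hij; exact e.injective hij
      · intro i hi; exact ⟨e.symm i, by simpa [S] using hi, by simp⟩
    rw [h1, Fin.card_filter_val_lt]
    omega
  have h1 := le_card_parity_ne_block_add (hρ.comp hS) hw hK p
  have h2 : ((Finset.Ico m (m + 2 * w * p)).filter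
      fun u => ¬ (Odd ((ρ ∘ S) u) ↔ Odd ((u + K) / w))).card ≤
        ((blockErrors ρ m w K p).filter fun S => Numbering.IsPrefix e S).card := by
    refine Finset.card_le_card_of_injOn S ?_ ?_
    · intro u hu
      rw [Finset.mem_coe, Finset.mem_filter, Finset.mem_Ico] at hu
      have hc := hcard u (by omega)
      rw [Finset.mem_coe, Finset.mem_filter, blockErrors, Finset.mem_filter, hc]
      refine ⟨⟨Finset.mem_univ _, hu⟩, fun i => ?_⟩
      rw [hc]
      simp [S]
    · intro u hu v hv huv
      rw [Finset.mem_coe, Finset.mem_filter, Finset.mem_Ico] at hu hv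
      rw [← hcard u (by omega), ← hcard v (by omega), huv]
  have h3 := Nat.mul_le_mul_left w (hg (S (m + 2 * w * p)))
  simp only [Function.comp_apply] at h1 h2
  omega

/-- Double counting of pairs of a numbering and an error that is a prefix of it. A set `S` is a
prefix with probability `1 / C(2m, |S|)`, at most `4 √m / 4 ^ m` near the middle. -/
theorem le_card_blockErrors {ρ : Finset ι → ℕ} (hρ : Monotone ρ) {g m w K p : ℕ}
    (hg : ∀ S, ρ S ≤ g) (hι : Fintype.card ι = 2 * m) (hw : 0 < w) (hK : 2 * w ∣ m + K)
    (hm : 1 ≤ m) (hp : 8 * (w * p) ^ 2 ≤ m) :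
    (w * p - w * g : ℝ) * 4 ^ m ≤ (blockErrors ρ m w K p).card * (4 * Real.sqrt m) := by
  have hpm : 2 * w * p ≤ m := by nlinarith
  have h1 : ((2 * m).factorial : ℝ) * (w * p - w * g) ≤
      ∑ S ∈ blockErrors ρ m w K p, ((Numbering.prefixed S).card : ℝ) := by
    have h2 : ∑ e : Numbering ι, (w * p - w * g : ℝ) ≤ ∑ e : Numbering ι,
        (((blockErrors ρ m w K p).filter fun S => Numbering.IsPrefix e S).card : ℝ) := by
      refine Finset.sum_le_sum fun e _ => ?_
      have h3 := le_card_prefix_blockErrors hρ hg hι hw hK hpm e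
      have h4 : (w * p : ℝ) ≤ (((blockErrors ρ m w K p).filter
        fun S => Numbering.IsPrefix e S).card : ℝ) + w * g := by exact_mod_cast h3
      linarith
    rw [Finset.sum_const, Finset.card_univ, Fintype.card_numbering, nsmul_eq_mul] at h2
    rw [← hι]
    refine h2.trans (le_of_eq ?_)
    simp only [Numbering.prefixed, Finset.card_filter, Nat.cast_sum]
    exact Finset.sum_comm
  have h2 : ∀ S ∈ blockErrors ρ m w K p, ((Numbering.prefixed S).card : ℝ) * 4 ^ m ≤
      (2 * m).factorial * (4 * Real.sqrt m) := by
    intro S hS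
    obtain ⟨hS1, hS2⟩ := (Finset.mem_filter.1 hS).2.1
    have h3 : 2 * (S.card - m) ^ 2 ≤ m := by
      have h4 : S.card - m ≤ 2 * (w * p) := by rw [← Nat.mul_assoc]; omega
      have h5 := Nat.pow_le_pow_left h4 2
      nlinarith
    have h4 := four_pow_le_mul_choose hm hS1 h3
    have h5 : S.card ≤ 2 * m := hι ▸ S.card_le_univ
    have h6 := Nat.choose_mul_factorial_mul_factorial h5
    rw [Numbering.card_prefixed, hι]
    have h7 : ((2 * m).factorial : ℝ) =
        (2 * m).choose S.card * (S.card.factorial * (2 * m - S.card).factorial : ℕ) := by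
      rw [← h6]; push_cast; ring
    rw [h7]
    calc _ ≤ ((S.card.factorial * (2 * m - S.card).factorial : ℕ) : ℝ) *
          (4 * Real.sqrt m * (2 * m).choose S.card) := by gcongr
      _ = _ := by ring
  have h3 := Finset.sum_le_card_nsmul _ _ _ h2
  rw [← Finset.sum_mul, nsmul_eq_mul] at h3
  have hpos : (0 : ℝ) < (2 * m).factorial := by positivity
  refine le_of_mul_le_mul_left ?_ hpos
  calc ((2 * m).factorial : ℝ) * ((w * p - w * g : ℝ) * 4 ^ m)
      = ((2 * m).factorial * (w * p - w * g : ℝ)) * 4 ^ m := by ring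
    _ ≤ (∑ S ∈ blockErrors ρ m w K p, ((Numbering.prefixed S).card : ℝ)) * 4 ^ m := by gcongr
    _ ≤ _ := h3
    _ = _ := by ring

end Slice

/-! ### From slices to the whole cube: distance to `g`-monotonicity -/

/-- The second moment for Chebyshev's inequality. The center `c` is arbitrary because the induction
replaces it by `c - 1`. -/
theorem sum_powerset_two_mul_card_sub_sq {α : Type*} [DecidableEq α] (s : Finset α) (c : ℝ) :
    ∑ S ∈ s.powerset, (2 * (S.card : ℝ) - c) ^ 2 = 2 ^ s.card * (s.card + (s.card - c) ^ 2) := by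
  induction s using Finset.induction_on generalizing c with
  | empty => simp
  | insert a s ha ih =>
    rw [Finset.sum_powerset_insert ha, ← Finset.sum_add_distrib]
    have h1 : ∀ S ∈ s.powerset, (2 * (S.card : ℝ) - c) ^ 2 + (2 * ((insert a S).card : ℝ) - c) ^ 2
        = 2 * (2 * (S.card : ℝ) - (c - 1)) ^ 2 + 2 := by
      intro S hS
      rw [Finset.card_insert_of_notMem fun h => ha (Finset.mem_powerset.1 hS h)]
      push_cast
      ring
    rw [Finset.sum_congr rfl h1, Finset.sum_add_distrib, ← Finset.mul_sum, ih,
      Finset.card_insert_of_notMem ha, Finset.sum_const, Finset.card_powerset, nsmul_eq_mul]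
    push_cast
    ring

/-- Most sets have a size within `√b` of `b / 2`. -/
theorem three_mul_two_pow_le_card_typical (κ : Type*) [Fintype κ] [DecidableEq κ] :
    (3 : ℝ) * 2 ^ Fintype.card κ ≤ 4 * ((Finset.univ : Finset (Finset κ)).filter
      fun Z => (2 * (Z.card : ℤ) - Fintype.card κ) ^ 2 ≤ 4 * Fintype.card κ).card := by
  set b := Fintype.card κ with hb
  have h1 := sum_powerset_two_mul_card_sub_sq (Finset.univ : Finset κ) b
  rw [Finset.powerset_univ, Finset.card_univ, ← hb, sub_self] at h1
  have h2 := Finset.card_filter_add_card_filter_not (s := (Finset.univ : Finset (Finset κ)))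
    (fun Z => (2 * (Z.card : ℤ) - b) ^ 2 ≤ 4 * b)
  rw [Finset.card_univ, Fintype.card_finset, ← hb] at h2
  set F := (Finset.univ : Finset (Finset κ)).filter fun Z => (2 * (Z.card : ℤ) - b) ^ 2 ≤ 4 * b
  set F' := (Finset.univ : Finset (Finset κ)).filter
    fun Z => ¬ (2 * (Z.card : ℤ) - b) ^ 2 ≤ 4 * b with hF'
  have h3 : (F.card : ℝ) + F'.card = 2 ^ b := by exact_mod_cast h2
  -- The `+ 1`, from integrality, covers `b = 0`.
  have h4 : (F'.card : ℝ) * (4 * b + 1) ≤ 2 ^ b * b := by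
    have h5 : (F'.card : ℝ) * (4 * b + 1) ≤ ∑ Z ∈ F', (2 * (Z.card : ℝ) - b) ^ 2 := by
      rw [← nsmul_eq_mul]
      refine Finset.card_nsmul_le_sum _ _ _ fun Z hZ => ?_
      have := (Finset.mem_filter.1 hZ).2
      have h6 : 4 * (b : ℤ) + 1 ≤ (2 * (Z.card : ℤ) - b) ^ 2 := by omega
      exact_mod_cast h6
    refine h5.trans ?_
    have h6 := Finset.sum_le_sum_of_subset_of_nonneg (Finset.filter_subset _ _ : F' ⊆ Finset.univ)
      (f := fun Z => (2 * (Z.card : ℝ) - b) ^ 2) (fun _ _ _ => sq_nonneg _)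
    rw [h1] at h6
    refine h6.trans (le_of_eq ?_)
    ring
  have hb0 : (0 : ℝ) ≤ b := by positivity
  have hp : (0 : ℝ) < 2 ^ b := by positivity
  have h5 : (F'.card : ℝ) * 4 ≤ 2 ^ b := by
    have : (0 : ℝ) < 4 * b + 1 := by positivity
    refine le_of_mul_le_mul_right ?_ this
    nlinarith
  linarith

/-- The point of the cube with support `S ∪ Z`, where `S ⊆ A` and `Z ⊆ Aᶜ`. -/
def glue (A : Finset (Fin n)) (S : Finset A) (Z : Finset (Aᶜ : Finset (Fin n))) : Cube n :=
  fun i => decide (i ∈ S.map (Function.Embedding.subtype _) ∪ Z.map (Function.Embedding.subtype _))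

theorem glue_eq_true_iff_of_mem {A : Finset (Fin n)} {S : Finset A}
    {Z : Finset (Aᶜ : Finset (Fin n))} {i : Fin n} (hi : i ∈ A) :
    glue A S Z i = true ↔ ⟨i, hi⟩ ∈ S := by
  simp [glue, hi]

theorem glue_eq_true_iff_of_mem_compl {A : Finset (Fin n)} {S : Finset A}
    {Z : Finset (Aᶜ : Finset (Fin n))} {i : Fin n} (hi : i ∈ Aᶜ) :
    glue A S Z i = true ↔ ⟨i, hi⟩ ∈ Z := by
  have := Finset.mem_compl.1 hi
  simp [glue, this]

theorem glue_injective {A : Finset (Fin n)} {S S' : Finset A} {Z Z' : Finset (Aᶜ : Finset (Fin n))}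
    (h : glue A S Z = glue A S' Z') : S = S' ∧ Z = Z' := by
  constructor
  · ext ⟨i, hi⟩
    rw [← glue_eq_true_iff_of_mem (Z := Z) hi, h, glue_eq_true_iff_of_mem hi]
  · ext ⟨i, hi⟩
    rw [← glue_eq_true_iff_of_mem_compl (S := S) hi, h, glue_eq_true_iff_of_mem_compl hi]

theorem glue_mono (A : Finset (Fin n)) (Z : Finset (Aᶜ : Finset (Fin n))) :
    Monotone fun S => glue A S Z := by
  intro S S' h i
  rw [Bool.le_iff_imp]
  by_cases hi : i ∈ A
  · rw [glue_eq_true_iff_of_mem hi, glue_eq_true_iff_of_mem hi]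
    exact fun h' => h h'
  · rw [glue_eq_true_iff_of_mem_compl (Finset.mem_compl.2 hi),
      glue_eq_true_iff_of_mem_compl (Finset.mem_compl.2 hi)]
    exact id

theorem weightOn_glue (A : Finset (Fin n)) (S : Finset A) (Z : Finset (Aᶜ : Finset (Fin n))) :
    weightOn A (glue A S Z) = S.card := by
  rw [weightOn, ← Finset.card_map (Function.Embedding.subtype _)]
  congr 1
  ext i
  by_cases hi : i ∈ A
  · simp [glue_eq_true_iff_of_mem hi, hi]
  · simp [hi]

theorem weightOn_univ_glue (A : Finset (Fin n)) (S : Finset A)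
    (Z : Finset (Aᶜ : Finset (Fin n))) :
    weightOn Finset.univ (glue A S Z) = S.card + Z.card := by
  rw [weightOn, ← Finset.card_map (Function.Embedding.subtype _) (s := S),
    ← Finset.card_map (Function.Embedding.subtype _) (s := Z), ← Finset.card_union_of_disjoint]
  · congr 1
    ext i
    simp [glue]
  · rw [Finset.disjoint_left]
    intro i h1 h2
    rw [Finset.mem_map] at h1 h2
    obtain ⟨j, -, rfl⟩ := h1
    obtain ⟨l, -, hl⟩ := h2
    have hl' : (l : Fin n) = j := hl
    exact Finset.mem_compl.1 l.2 (hl' ▸ j.2)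

/-- The function `blockParity A w K` is far from every `g`-monotone function, if `A` is so large
that the weight on `A` usually ranges over many more than `g` blocks. -/
theorem one_hundredth_lt_relDist_blockParity {A : Finset (Fin n)} {m w K p g : ℕ}
    (hA : A.card = 2 * m) (hw : 0 < w) (hK : 2 * w ∣ m + K) (hm : 1 ≤ m) (hgp : 2 * g ≤ p)
    (hp : 8 * (w * p) ^ 2 ≤ m) (hp' : m ≤ 32 * (w * p) ^ 2) {h : BoolFun n}
    (hh : h ∈ kMonotone n g) : 1 / 100 < relDist (blockParity A w K) h := by
  obtain ⟨ρ, hρ, hg, hρh⟩ := exists_rank (Q := Set.univ) (f := h) (k := g) (by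
    rintro ⟨x, -, hx⟩
    exact hh ⟨x, hx⟩)
  set b := Fintype.card (Aᶜ : Finset (Fin n)) with hb
  have hn : 2 * m + b = n := by
    have h1 := A.card_add_card_compl
    rw [hb, Fintype.card_coe, ← hA, h1, Fintype.card_fin]
  set typ := (Finset.univ : Finset (Finset (Aᶜ : Finset (Fin n)))).filter
    fun Z => (2 * (Z.card : ℤ) - b) ^ 2 ≤ 4 * b with htyp
  let err : Finset (Aᶜ : Finset (Fin n)) → Finset (Finset A) :=
    fun Z => blockErrors (fun S => ρ (glue A S Z)) m w K p
  have herr : ∀ Z, (w * p - w * g : ℝ) * 4 ^ m ≤ (err Z).card * (4 * Real.sqrt m) := fun Z =>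
    le_card_blockErrors (hρ.comp (glue_mono A Z)) (fun S => hg _) (by simpa using hA) hw hK hm hp
  have hcard : ∑ Z ∈ typ, (err Z).card ≤
      (Finset.univ.filter fun x => blockParity A w K x ≠ h x).card := by
    rw [← Finset.card_sigma]
    refine Finset.card_le_card_of_injOn (fun q => glue A q.2 q.1) ?_ ?_
    · rintro ⟨Z, S⟩ hZS
      rw [Finset.mem_coe, Finset.mem_sigma] at hZS
      obtain ⟨hZ, hS⟩ := hZS
      have hZ' := (Finset.mem_filter.1 hZ).2
      obtain ⟨-, ⟨hS1, hS2⟩, hS3⟩ := Finset.mem_filter.1 hS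
      dsimp only at hZ' hS1 hS2 hS3
      -- The deviations on `A` and `Aᶜ` have squares at most `2m` and `4b`, so their sum has square
      -- at most `4m + 8b ≤ 16n`.
      have hmid : IsMiddle (glue A S Z) := by
        unfold IsMiddle
        rw [weightOn_univ_glue]
        have h1 : (2 * (S.card : ℤ) - 2 * m) ^ 2 ≤ 2 * m := by
          have h2 : (0 : ℤ) ≤ 2 * S.card - 2 * m := by omega
          have h3 : (2 * S.card - 2 * m : ℤ) ≤ 4 * (w * p) := by
            have : (S.card : ℤ) < m + 2 * w * p := by exact_mod_cast hS2
            linarith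
          have h4 : (8 * (w * p) ^ 2 : ℤ) ≤ m := by exact_mod_cast hp
          nlinarith
        have h2 : (n : ℤ) = 2 * m + b := by exact_mod_cast hn.symm
        rw [h2]
        push_cast
        have hm0 : (0 : ℤ) ≤ m := by positivity
        nlinarith [sq_nonneg ((2 * (S.card : ℤ) - 2 * m) - (2 * (Z.card : ℤ) - b))]
      simp only [Finset.coe_filter, Finset.mem_univ, true_and]
      change blockParity A w K (glue A S Z) ≠ h (glue A S Z)
      rw [hρh _ (Set.mem_univ _)]
      unfold blockParity
      rw [weightOn_glue]
      simp only [hmid, true_and, ne_eq, decide_eq_decide]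
      exact fun h' => hS3 h'.symm
    · rintro ⟨Z, S⟩ - ⟨Z', S'⟩ - hq
      obtain ⟨rfl, rfl⟩ := glue_injective hq
      rfl
  have htypcard : (3 : ℝ) * 2 ^ b ≤ 4 * typ.card :=
    three_mul_two_pow_le_card_typical (Aᶜ : Finset (Fin n))
  unfold relDist
  set N := (Finset.univ.filter fun x => blockParity A w K x ≠ h x).card
  have hN : ∑ Z ∈ typ, ((err Z).card : ℝ) ≤ N := by exact_mod_cast hcard
  have h1 : (typ.card : ℝ) * ((w * p - w * g : ℝ) * 4 ^ m) ≤ N * (4 * Real.sqrt m) := by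
    rw [← nsmul_eq_mul]
    refine (Finset.card_nsmul_le_sum _ _ _ fun Z _ => herr Z).trans ?_
    rw [← Finset.sum_mul]
    gcongr
  have hm0 : (0 : ℝ) < m := by exact_mod_cast hm
  have hs : 0 < Real.sqrt m := Real.sqrt_pos.2 hm0
  have h2 : Real.sqrt m ≤ 6 * (w * p : ℝ) := by
    refine Real.sqrt_le_iff.2 ⟨by positivity, ?_⟩
    have : (m : ℝ) ≤ 32 * (w * p) ^ 2 := by exact_mod_cast hp'
    nlinarith [sq_nonneg (w * p : ℝ)]
  have h3 : Real.sqrt m ≤ 12 * (w * p - w * g : ℝ) := by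
    have h4 : (w * (2 * g) : ℝ) ≤ w * p := by exact_mod_cast Nat.mul_le_mul_left w hgp
    linarith
  have h4 : (2 : ℝ) ^ n = 2 ^ b * 4 ^ m := by
    rw [← hn, pow_add, pow_mul]
    norm_num [mul_comm]
  rw [lt_div_iff₀ (by positivity)]
  -- Here `192 = 4 · 12 · 4`, and `3 / 192 = 1 / 64` exceeds `1 / 100`.
  have h5 : (3 : ℝ) * 2 ^ b * (Real.sqrt m * 4 ^ m) ≤ 192 * N * Real.sqrt m := by
    calc (3 : ℝ) * 2 ^ b * (Real.sqrt m * 4 ^ m)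
        ≤ 4 * typ.card * (12 * (w * p - w * g : ℝ) * 4 ^ m) := by gcongr
      _ = 48 * (typ.card * ((w * p - w * g : ℝ) * 4 ^ m)) := by ring
      _ ≤ 48 * (N * (4 * Real.sqrt m)) := by gcongr
      _ = _ := by ring
  have h6 : (3 : ℝ) * 2 ^ n ≤ 192 * N := by
    refine le_of_mul_le_mul_right ?_ hs
    rw [h4]
    linarith
  have h7 : (0 : ℝ) < 2 ^ n := by positivity
  linarith

/-- If `A` is large compared with `w` and `g`, then `blockParity A w K` is at distance more than
`1 / 100` from `g`-monotonicity. -/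
theorem one_hundredth_lt_distTo_blockParity {A : Finset (Fin n)} {m w K g : ℕ}
    (hA : A.card = 2 * m) (hw : 0 < w) (hK : 2 * w ∣ m + K) (hg : 0 < g)
    (h : 32 * (w * g) ^ 2 ≤ m) : 1 / 100 < distTo (blockParity A w K) (kMonotone n g) := by
  obtain ⟨f, hf, hd⟩ := exists_relDist_eq_distTo (blockParity A w K) (kMonotone_nonempty n g)
  rw [← hd]
  have hw2 : 0 < 8 * w ^ 2 := by positivity
  -- This root is the largest `p` with `8(wp)² ≤ m`; maximality gives the reverse bound up to a
  -- factor `4`.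
  have hp : 2 * g ≤ Nat.sqrt (m / (8 * w ^ 2)) := by
    rw [Nat.le_sqrt', Nat.le_div_iff_mul_le hw2]
    calc (2 * g) ^ 2 * (8 * w ^ 2) = 32 * (w * g) ^ 2 := by ring
      _ ≤ m := h
  have h1 := Nat.sqrt_le' (m / (8 * w ^ 2))
  have h2 := Nat.lt_succ_sqrt' (m / (8 * w ^ 2))
  set p := Nat.sqrt (m / (8 * w ^ 2))
  rw [Nat.le_div_iff_mul_le hw2] at h1
  rw [Nat.div_lt_iff_lt_mul hw2] at h2
  have hm : 1 ≤ m := by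
    have : 0 < 32 * (w * g) ^ 2 := by positivity
    omega
  refine one_hundredth_lt_relDist_blockParity hA hw hK hm hp ?_ ?_ hf
  · calc 8 * (w * p) ^ 2 = p ^ 2 * (8 * w ^ 2) := by ring
      _ ≤ m := h1
  · refine h2.le.trans ?_
    have : p.succ ≤ 2 * p := by omega
    calc p.succ ^ 2 * (8 * w ^ 2) ≤ (2 * p) ^ 2 * (8 * w ^ 2) := by gcongr
      _ = 32 * (w * p) ^ 2 := by ring

/-! ### Choice of the parameters -/

theorem DetNonadaptive.Finds.lt_queries {q k : ℕ} {B : DetNonadaptive n q} {f : BoolFun n}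
    (h : B.Finds k f) : k < q := by
  obtain ⟨x, hx, hv, -⟩ := h
  choose i hi using hx
  have hinj : Function.Injective i := fun a b hab => hv.injective (by rw [← hi, ← hi, hab])
  have := Fintype.card_le_of_injective i hinj
  simp only [Fintype.card_fin] at this
  omega

/-- Covers the range in which the exponential bound is below a constant. -/
theorem IsOneSidedTester.lt_queries {q k l : ℕ} {ε : ℝ} {T : RandNonadaptive n q}
    (hT : IsOneSidedTester k l ε T) {f : BoolFun n} (hf : ε < distTo f (kMonotone n l)) :
    k < q := by
  classical
  by_contra h
  have h1 := hT.two_thirds_card_le {()} (fun _ => f) 0 (fun _ _ => hf) fun B => by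
    rw [Finset.filter_false_of_mem fun _ _ hB => h hB.lt_queries]
    simp
  simp at h1

/-- The shift is `-m` modulo `2w`, as a natural number: a double block then starts at the middle
layer of the cube on `A`. -/
theorem dvd_add_shift {w : ℕ} (hw : 0 < w) (m : ℕ) : 2 * w ∣ m + (2 * w - 1) * m := by
  obtain ⟨v, hv⟩ := Nat.exists_eq_add_of_le (show 1 ≤ 2 * w by omega)
  refine ⟨m, ?_⟩
  rw [hv, Nat.add_sub_cancel_left]
  ring

/-- The lower bound on the number of queries in terms of the length `w` of the blocks. -/
theorem IsOneSidedTester.exp_half_le_sq {q k g w : ℕ} {ε : ℝ} {T : RandNonadaptive n q}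
    (hT : IsOneSidedTester k g ε T) (hε : ε ≤ 1 / 100) (hk : 2 ≤ k) (hg : 0 < g) (hn : 0 < n)
    (hw : 0 < w) (hwn : 64 * (w * g) ^ 2 ≤ n) (h : 6144 * (w * g ^ 2 : ℝ) ≤ k * Real.sqrt n) :
    Real.exp ((w : ℝ) / 2) ≤ (q : ℝ) ^ 2 := by
  classical
  set m := 32 * (w * g) ^ 2 with hm
  set t := w * (2 * (k / 2) - 1) with ht
  have hmn : 2 * m ≤ n := by omega
  have hcond : 32 * ((2 * m : ℕ) : ℝ) ≤ Real.sqrt n * t := by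
    -- The factor `3` is attained at `k = 3`; together with `32 · 64` from `32 · 2m` it gives
    -- `6144`.
    have h1 : (w * k : ℝ) ≤ 3 * t := by
      have h2 : k ≤ 3 * (2 * (k / 2) - 1) := by omega
      have h3 := Nat.mul_le_mul_left w h2
      have h4 : w * k ≤ 3 * t := by rw [ht]; linarith
      exact_mod_cast h4
    have hs : 0 ≤ Real.sqrt n := Real.sqrt_nonneg _
    rw [hm]
    push_cast
    have h5 := mul_le_mul_of_nonneg_left h (Nat.cast_nonneg w : (0 : ℝ) ≤ w)
    have h6 := mul_le_mul_of_nonneg_left h1 hs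
    nlinarith
  have hfar : ∀ A ∈ Finset.powersetCard (2 * m) (Finset.univ : Finset (Fin n)),
      ε < distTo (blockParity A w ((2 * w - 1) * m)) (kMonotone n g) := fun A hA =>
    hε.trans_lt (one_hundredth_lt_distTo_blockParity (Finset.mem_powersetCard.1 hA).2 hw
      (dvd_add_shift hw m) hg le_rfl)
  have h1 := hT.two_thirds_card_le _ _ _ hfar fun B =>
    Nat.le_floor (B.card_finds_blockParity_le hn hw hk hmn hcond)
  rw [Finset.card_powersetCard, Finset.card_univ, Fintype.card_fin] at h1
  have hC : (0 : ℝ) < n.choose (2 * m) := by exact_mod_cast Nat.choose_pos hmn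
  have h2 : (2 * n.choose (2 * m) : ℝ) ≤
      3 * (q ^ 2 * (Real.exp (-t) * n.choose (2 * m))) := by
    have h3 : (2 * n.choose (2 * m) : ℝ) ≤
        3 * (⌊(q ^ 2 * (Real.exp (-t) * n.choose (2 * m)) : ℝ)⌋₊ : ℕ) := by exact_mod_cast h1
    have h4 := Nat.floor_le (show (0 : ℝ) ≤ q ^ 2 * (Real.exp (-t) * n.choose (2 * m)) by
      positivity)
    linarith
  have h3 : 2 * Real.exp t ≤ 3 * (q : ℝ) ^ 2 := by
    refine le_of_mul_le_mul_right ?_ hC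
    have h4 : Real.exp t * Real.exp (-t) = 1 := by rw [← Real.exp_add]; simp
    calc 2 * Real.exp t * n.choose (2 * m) = Real.exp t * (2 * n.choose (2 * m)) := by ring
      _ ≤ Real.exp t * (3 * (q ^ 2 * (Real.exp (-t) * n.choose (2 * m)))) := by gcongr
      _ = (Real.exp t * Real.exp (-t)) * (3 * q ^ 2 * n.choose (2 * m)) := by ring
      _ = _ := by rw [h4, one_mul]
  have hwt : (w : ℝ) ≤ t := by
    have : w ≤ t := Nat.le_mul_of_pos_right w (by omega)
    exact_mod_cast this
  have hw1 : (1 : ℝ) ≤ w := by exact_mod_cast hw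
  have h4 : Real.exp w = Real.exp ((w : ℝ) / 2) * Real.exp ((w : ℝ) / 2) := by
    rw [← Real.exp_add]; ring_nf
  have h5 : Real.exp w ≤ Real.exp t := Real.exp_le_exp.2 hwt
  -- Since `w ≥ 1`, half of the exponent absorbs the factor `3 / 2`.
  have h6 := Real.add_one_le_exp ((w : ℝ) / 2)
  nlinarith

theorem IsOneSidedTester.exp_le_queries {q k g : ℕ} {ε : ℝ} {T : RandNonadaptive n q}
    (hT : IsOneSidedTester k g ε T) (hε : ε ≤ 1 / 100) (hk : 2 ≤ k) (hkg : k ≤ g)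
    (hgn : 100 * g ^ 2 ≤ n) :
    Real.exp (1 / 50000 * (Real.sqrt n / (((k : ℝ) + 1) * ((g : ℝ) / k) ^ 2))) ≤ q := by
  have hg : 0 < g := by omega
  have hn : 0 < n := by
    have : 0 < 100 * g ^ 2 := by positivity
    omega
  have hg0 : (0 : ℝ) < g := by exact_mod_cast hg
  have hk0 : (0 : ℝ) < k := by exact_mod_cast (by omega : 0 < k)
  have hs : 0 ≤ Real.sqrt n := Real.sqrt_nonneg _
  set Y := k * Real.sqrt n / (g : ℝ) ^ 2 with hY
  have hYg : Y * (g : ℝ) ^ 2 = k * Real.sqrt n := by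
    rw [hY]; field_simp
  have hY0 : 0 ≤ Y := by positivity
  have hE : Real.sqrt n / (((k : ℝ) + 1) * ((g : ℝ) / k) ^ 2) ≤ Y := by
    rw [div_le_iff₀ (by positivity)]
    calc Real.sqrt n = (k * Real.sqrt n) / k := by field_simp
      _ ≤ (k * Real.sqrt n) * (k + 1) / k ^ 2 := by
        rw [div_le_div_iff₀ hk0 (by positivity)]
        have : 0 ≤ k * Real.sqrt n * k := by positivity
        nlinarith
      _ = Y * (((k : ℝ) + 1) * ((g : ℝ) / k) ^ 2) := by rw [← hYg]; field_simp
  -- For small `Y` no block length `w ≥ 1` is admissible, but then the exponent is below `1` and `q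
  -- ≥ k + 1 ≥ 3 > e` suffices.
  rcases lt_or_ge Y 6144 with hlt | hge
  · obtain ⟨A, -, hA⟩ := Finset.exists_subset_card_eq (s := (Finset.univ : Finset (Fin n)))
      (n := 2 * (n / 2)) (by rw [Finset.card_univ, Fintype.card_fin]; omega)
    have h3 : 3 ≤ q := by
      have := hT.lt_queries (hε.trans_lt (one_hundredth_lt_distTo_blockParity hA one_pos
        (dvd_add_shift one_pos _) hg (by rw [Nat.one_mul]; omega)))
      omega
    have h4 : (3 : ℝ) ≤ q := by exact_mod_cast h3
    refine le_trans ?_ h4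
    calc _ ≤ Real.exp 1 := Real.exp_le_exp.2 (by linarith)
      _ ≤ 3 := by linarith [Real.exp_one_lt_d9]
  · set w := ⌊Y / 6144⌋₊ with hw
    have hw1 : 0 < w := Nat.floor_pos.2 (by linarith)
    have hwY : (w : ℝ) ≤ Y / 6144 := Nat.floor_le (by positivity)
    have hYw : Y / 6144 < w + 1 := Nat.lt_floor_add_one _
    have hw1' : (1 : ℝ) ≤ w := by exact_mod_cast hw1
    have hcond : 6144 * (w * g ^ 2 : ℝ) ≤ k * Real.sqrt n := by
      rw [← hYg]
      have : 0 ≤ (g : ℝ) ^ 2 := by positivity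
      nlinarith
    have hwn : 64 * (w * g) ^ 2 ≤ n := by
      have h1 : 6144 * (w * g : ℝ) ≤ Real.sqrt n := by
        refine le_of_mul_le_mul_left ?_ hg0
        have h2 : (k : ℝ) * Real.sqrt n ≤ g * Real.sqrt n := by gcongr
        linarith
      have h2 : (6144 * (w * g : ℝ)) ^ 2 ≤ n := by
        rw [← Real.sq_sqrt (Nat.cast_nonneg (α := ℝ) n)]
        gcongr
      have h3 : (64 * (w * g) ^ 2 : ℝ) ≤ n := by nlinarith [sq_nonneg (w * g : ℝ)]
      exact_mod_cast h3
    have h1 := hT.exp_half_le_sq hε hk hg hn hw1 hwn hcond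
    refine le_of_sq_le_sq ?_ (Nat.cast_nonneg q)
    refine le_trans ?_ h1
    rw [← Real.exp_nat_mul]
    refine Real.exp_le_exp.2 ?_
    -- From `w ≥ 1`, `Y / 6144 < 2w`, so `w / 2 > Y / 24576`, which exceeds the required `2Y /
    -- 50000`.
    push_cast
    linarith

end PropertyTesting

theorem mainTheorem3 :
    ∃ c : ℝ, 0 < c ∧ ∃ ε₀ : ℝ, 0 < ε₀ ∧
      ∀ (k : ℕ → ℕ) (g : ℕ → ℕ → ℕ),
        (∀ᶠ n : ℕ in atTop, 2 ≤ k n ∧ k n ≤ g (k n) n) →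
        (fun n : ℕ => (g (k n) n : ℝ)) =o[atTop] (fun n : ℕ => Real.sqrt (n : ℝ)) →
        ∀ᶠ n : ℕ in atTop, ∀ ε : ℝ, 0 < ε → ε ≤ ε₀ →
          ∀ (q : ℕ) (T : RandNonadaptive n q), IsOneSidedTester (k n) (g (k n) n) ε T →
            Real.exp (c * (Real.sqrt (n : ℝ) /
              (((k n : ℝ) + 1) * ((g (k n) n : ℝ) / (k n : ℝ)) ^ 2))) ≤ (q : ℝ) := by
  refine ⟨1 / 50000, by norm_num, 1 / 100, by norm_num, fun k g hkg ho => ?_⟩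
  filter_upwards [hkg, ho.def (show (0 : ℝ) < 1 / 10 by norm_num)] with n hn hgn ε _ hε q T hT
  refine hT.exp_le_queries hε hn.1 hn.2 ?_
  rw [Real.norm_of_nonneg (by positivity), Real.norm_of_nonneg (by positivity)] at hgn
  have h1 : ((g (k n) n : ℝ)) ^ 2 ≤ (1 / 10 * Real.sqrt n) ^ 2 := by gcongr
  rw [mul_pow, Real.sq_sqrt (by positivity)] at h1
  have h2 : (100 * (g (k n) n) ^ 2 : ℝ) ≤ n := by linarith
  exact_mod_cast h2
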